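/- Let $p$ be a prime and $n\ge 0$, $m\ge 1$ integers. Let $\mathcal{L}_n=(\mathbb{Z}/p\mathbb{Z})^n\wr\mathbb{Z}=\bigl(\bigoplus_{\mathbb{Z}}(\mathbb{Z}/p\mathbb{Z})^n\bigr)\rtimes\mathbb{Z}$, where the generator of $\mathbb{Z}$ acts on the direct sum by the shift by one, and let $a_m(\mathcal{L}_n)$ be the number of subgroups of $\mathcal{L}_n$ of index $m$. Let $R=\mathbb{F}_p[x,x^{-1}]$ and, for integers $k,t\ge 0$, let $b_t(R^k)$ be the number of $R$-submodules $M\subseteq R^k$ with $\dim_{\mathbb{F}_p}R^k/M=t$. Then $a_m(\mathcal{L}_n)$ is finite and $$a_m(\mathcal{L}_n)=\sum_{t\ge 0,\;p^t\mid m} b_t\bigl(R^{nm/p^t}\bigr)\,p^t=1+\sum_{t\ge 1,\;p^t\mid m}\Bigl(p^{nmt/p^t}-p^{nm(t-1)/p^t}\Bigr)p^t .$$ -/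

import Mathlib

namespace Lamplighter

/-- The base group `⊕_ℤ (ℤ/pℤ)ⁿ` : finitely supported functions `ℤ → (ℤ/pℤ)ⁿ`. -/
abbrev Base (p n : ℕ) : Type := ℤ →₀ (Fin n → ZMod p)

/-- The action of `ℤ` on the base group by shifts: the generator `1 ∈ ℤ` acts as the right
shift by one, so that `s ∈ ℤ` sends `v` to the function `i ↦ v (i - s)`
(see `shift_apply`). -/
noncomputable def shift (p n : ℕ) : Multiplicative ℤ →* MulAut (Multiplicative (Base p n)) where
  toFun s := AddEquiv.toMultiplicative
    (Finsupp.domCongr (Equiv.addRight (Multiplicative.toAdd s)) : Base p n ≃+ Base p n)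
  map_one' := by
    ext v i : 3
    change (Multiplicative.toAdd v) (i + -0) = (Multiplicative.toAdd v) i
    rw [neg_zero, add_zero]
  map_mul' s t := by
    ext v i : 3
    change (Multiplicative.toAdd v) (i + -(Multiplicative.toAdd s + Multiplicative.toAdd t))
      = (Multiplicative.toAdd v) (i + -Multiplicative.toAdd s + -Multiplicative.toAdd t)
    rw [neg_add, add_assoc]

theorem shift_apply (p n : ℕ) (s i : ℤ) (v : Base p n) :
    Multiplicative.toAdd (shift p n (Multiplicative.ofAdd s) (Multiplicative.ofAdd v)) i
      = v (i - s) := by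
  simp [shift, sub_eq_add_neg]

/-- The group `𝓛ₙ = (ℤ/pℤ)ⁿ ≀ ℤ = (⊕_ℤ (ℤ/pℤ)ⁿ) ⋊ ℤ`, with multiplication
`(v, s)(w, t) = (v + xˢ w, s + t)`, where `x` is the right shift. -/
abbrev LGroup (p n : ℕ) : Type :=
  Multiplicative (Base p n) ⋊[shift p n] Multiplicative ℤ

/-- `a_m(𝓛ₙ)`: the number (in `ℕ ∪ {∞}`) of subgroups of index `m ≥ 1` of `𝓛ₙ`. -/
noncomputable def subgroupCount (p n m : ℕ) : ℕ∞ :=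
  {H : Subgroup (LGroup p n) | H.index = m}.encard

/-- `b_t(Rᵏ)`, for `R = 𝔽_p[x, x⁻¹]`: the number (in `ℕ ∪ {∞}`) of `R`-submodules `M` of `Rᵏ`
with `dim_{𝔽_p} Rᵏ / M = t`. The dimension is a cardinal, so that infinite codimension is not
confused with codimension `0`. -/
noncomputable def submoduleCount (p k t : ℕ) : ℕ∞ :=
  {M : Submodule (LaurentPolynomial (ZMod p)) (Fin k → LaurentPolynomial (ZMod p)) |
    Module.rank (ZMod p) ((Fin k → LaurentPolynomial (ZMod p)) ⧸ M) = t}.encard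

end Lamplighter

namespace Lamplighter

/-! ### Counting by fibres -/

/-! A subgroup `H` of finite index `m` has an image `dℤ` in `ℤ` and a trace `W` on the base, with `m
= d * [Base : W]`. The base has exponent `p`, so `[Base : W] = p ^ t`, and `W` is invariant under
the shift by `d = m / p ^ t`. Conversely, for such a `W`, the subgroups with data `(d, W)` are
generated by `W` and a lift `(v, d)` of `d`; only the class of `v` modulo `W` matters, so there are
`p ^ t` of them (`ncard_subgroups_of_comap_eq`). Sorting coordinates by residue modulo `d` turns the
base with its shift by `d` into the free module `R ^ (n * d)`, so the `W` are counted by `b_t`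
(`encard_invariantSubgroups`). This gives the first formula.

The numbers `b_t(R ^ k)` come from the same argument for modules: a submodule of `A × R` of finite
index is given by its image `(g)` in `R`, its trace `N` on `A`, and a lift of `g` modulo `N`. With
`B_k(u) = ∑ b_t(R ^ k) u ^ t` this reads `B_{k+1}(u) = B_1(u) B_k(p u)`. Nonzero ideals of `R`
correspond to monic polynomials with nonzero constant term, so `B_1 = (1 - u) / (1 - p u)`, and the
product telescopes to `B_k = (1 - u) / (1 - p ^ k u)`. -/

theorem encard_eq_sum_fiber {α ι : Type*} (s : Set α) (T : Finset ι) (f : α → ι)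
    (h : ∀ a ∈ s, f a ∈ T) : s.encard = ∑ i ∈ T, {a ∈ s | f a = i}.encard := by
  classical
  have key : ∀ T : Finset ι, {a ∈ s | f a ∈ T}.encard = ∑ i ∈ T, {a ∈ s | f a = i}.encard := by
    intro T
    induction T using Finset.induction_on with
    | empty => simp
    | insert i T hi ih =>
      rw [Finset.sum_insert hi, ← ih, ← Set.encard_union_eq]
      · congr 1
        ext a
        simp only [Finset.mem_insert, Set.mem_ofPred_eq, Set.mem_union]
        tauto
      · rw [Set.disjoint_left]
        rintro a ⟨_, rfl⟩ ⟨_, ha⟩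
        exact hi ha
  rw [← key T]
  congr 1
  ext a
  exact ⟨fun ha => ⟨ha, h a ha⟩, fun ha => ha.1⟩

/-- Since `ncard` is `0` on infinite sets, `c ≠ 0` is what forces the fibres to be finite. -/
theorem encard_eq_mul_of_fiber {α β : Type*} (s : Set α) (t : Set β) (f : α → β) (c : ℕ)
    (hc : c ≠ 0) (hf : ∀ a ∈ s, f a ∈ t) (h : ∀ b ∈ t, {a ∈ s | f a = b}.ncard = c) :
    s.encard = t.encard * c := by
  let g : s → t := fun a => ⟨f a, hf a a.2⟩
  have hcard : ∀ b : t, Nat.card {a : s // g a = b} = c := by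
    intro b
    rw [← h b b.2, ← Nat.card_coe_set_eq]
    exact Nat.card_congr
      { toFun := fun a => ⟨a.1.1, a.1.2, congrArg Subtype.val a.2⟩
        invFun := fun a => ⟨⟨a.1, a.2.1⟩, Subtype.ext a.2.2⟩
        left_inv := fun _ => rfl
        right_inv := fun _ => rfl }
  have e : ∀ b : t, Nonempty ({a : s // g a = b} ≃ Fin c) := fun b => by
    have : Finite {a : s // g a = b} := Nat.finite_of_card_ne_zero (by rw [hcard]; exact hc)
    exact ⟨Finite.equivFinOfCardEq (hcard b)⟩
  let e := fun b => (e b).some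
  let E : s ≃ t × Fin c :=
    (Equiv.sigmaFiberEquiv g).symm.trans ((Equiv.sigmaCongrRight e).trans (Equiv.sigmaEquivProd _ _))
  rw [Set.encard, ENat.card_congr E, ENat.card_prod, Set.encard, ENat.card_eq_coe_natCard (Fin c),
    Nat.card_fin]

theorem encard_eq_of_bijOn {α β : Type*} {s : Set α} {t : Set β} (f : α → β)
    (h : Set.BijOn f s t) : s.encard = t.encard := by
  rw [← h.image_eq, h.injOn.encard_image]

/-- Counts the lifts of a generator, for submodules and for subgroups alike: `g v` is the object
built from the lift `v`. -/
theorem ncard_range_eq_index {V α : Type*} [AddGroup V] (W : AddSubgroup V) (g : V → α)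
    (h : ∀ v w, g v = g w ↔ -v + w ∈ W) : (Set.range g).ncard = W.index := by
  rw [← Nat.card_coe_set_eq, AddSubgroup.index]
  symm
  refine Nat.card_congr (Equiv.ofBijective (fun q : V ⧸ W => Quotient.liftOn' q
    (fun v => (⟨g v, v, rfl⟩ : Set.range g)) fun v w hvw =>
      Subtype.ext ((h v w).2 (QuotientAddGroup.leftRel_apply.1 hvw))) ⟨?_, ?_⟩)
  · rintro ⟨v⟩ ⟨w⟩ hvw
    exact Quotient.sound' (QuotientAddGroup.leftRel_apply.2 ((h v w).1 (congrArg Subtype.val hvw)))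
  · rintro ⟨_, v, rfl⟩
    exact ⟨Quotient.mk'' v, rfl⟩

/-! ### Indices in extensions -/

/-- As `H ⊔ K = K * H`, every left coset of `H` in it meets `K`; `H` itself need not be normal. -/
theorem relIndex_sup_of_normal {G : Type*} [Group G] (H K : Subgroup G) [K.Normal] :
    H.relIndex (H ⊔ K) = H.relIndex K := by
  symm
  refine Nat.card_congr (Equiv.ofBijective
    (Subgroup.quotientSubgroupOfEmbeddingOfLE H (le_sup_right : K ≤ H ⊔ K))
    ⟨(Subgroup.quotientSubgroupOfEmbeddingOfLE H (le_sup_right : K ≤ H ⊔ K)).injective, ?_⟩)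
  rintro ⟨⟨x, hx⟩⟩
  have hx' := hx
  rw [sup_comm, ← SetLike.mem_coe, Subgroup.normal_mul, Set.mem_mul] at hx'
  obtain ⟨k, hk, h, hh, rfl⟩ := hx'
  refine ⟨QuotientGroup.mk ⟨k, hk⟩, ?_⟩
  refine QuotientGroup.eq.2 ?_
  rw [Subgroup.mem_subgroupOf]
  simpa using hh

theorem index_eq_index_map_mul_index_comap {N G Q : Type*} [Group N] [Group G] [Group Q]
    (f : N →* G) (g : G →* Q) (hg : Function.Surjective g) (hfg : f.range = g.ker)
    (H : Subgroup G) : H.index = (H.map g).index * (H.comap f).index := by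
  rw [Subgroup.index_map, Subgroup.index_comap, hfg, MonoidHom.range_eq_top_of_surjective g hg,
    Subgroup.index_top, mul_one, ← relIndex_sup_of_normal, mul_comm,
    Subgroup.relIndex_mul_index le_sup_left]

theorem addIndex_eq_index_map_mul_index_comap {N G Q : Type*} [AddCommGroup N] [AddCommGroup G]
    [AddCommGroup Q] (f : N →+ G) (g : G →+ Q) (hg : Function.Surjective g)
    (hfg : f.range = g.ker) (H : AddSubgroup G) :
    H.index = (H.map g).index * (H.comap f).index := by
  rw [AddSubgroup.index_map, AddSubgroup.index_comap, hfg,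
    AddMonoidHom.range_eq_top_of_surjective g hg, AddSubgroup.index_top, mul_one,
    ← AddSubgroup.relIndex_sup_left, mul_comm, AddSubgroup.relIndex_mul_index le_sup_left]

/-! ### Submodules of finite index -/

/-- The number of `R`-submodules of `A` of index `N`. -/
noncomputable def submoduleIndexCount (R A : Type*) [CommRing R] [AddCommGroup A] [Module R A]
    (N : ℕ) : ℕ∞ :=
  {M : Submodule R A | M.toAddSubgroup.index = N}.encard

theorem submoduleIndexCount_congr {R A B : Type*} [CommRing R] [AddCommGroup A] [Module R A]
    [AddCommGroup B] [Module R B] (e : A ≃ₗ[R] B) (N : ℕ) :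
    submoduleIndexCount R A N = submoduleIndexCount R B N := by
  have key : ∀ M : Submodule R A,
      (M.map (e : A →ₗ[R] B)).toAddSubgroup.index = M.toAddSubgroup.index := fun M =>
    AddSubgroup.index_map_equiv M.toAddSubgroup e.toAddEquiv
  refine encard_eq_of_bijOn (fun M => M.map (e : A →ₗ[R] B)) ⟨?_, ?_, ?_⟩
  · intro M hM
    exact (key M).trans hM
  · exact (Submodule.map_injective_of_injective e.injective).injOn
  · intro M hM
    have hM' : (M.comap (e : A →ₗ[R] B)).map (e : A →ₗ[R] B) = M :=
      Submodule.map_comap_eq_of_surjective e.surjective M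
    refine ⟨M.comap (e : A →ₗ[R] B), ?_, hM'⟩
    change (M.comap (e : A →ₗ[R] B)).toAddSubgroup.index = N
    rw [← key, hM']
    exact hM

theorem submoduleIndexCount_of_subsingleton (R A : Type*) [CommRing R] [AddCommGroup A]
    [Module R A] [Subsingleton A] (N : ℕ) :
    submoduleIndexCount R A N = if N = 1 then 1 else 0 := by
  have h : ∀ M : Submodule R A, M.toAddSubgroup.index = 1 := fun M =>
    AddSubgroup.index_eq_one.2 (Subsingleton.elim _ _)
  rw [submoduleIndexCount]
  split_ifs with hN
  · subst hN
    rw [Set.encard_eq_one]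
    exact ⟨⊤, by ext M; simp [h, Subsingleton.elim M ⊤]⟩
  · rw [Set.encard_eq_zero, Set.eq_empty_iff_forall_notMem]
    intro M hM
    exact hN ((h M).symm.trans hM).symm

section Prod

variable {R A : Type*} [CommRing R] [AddCommGroup A] [Module R A]

theorem index_submodule_prod (M : Submodule R (A × R)) :
    M.toAddSubgroup.index = (M.map (LinearMap.snd R A R)).toAddSubgroup.index *
      (M.comap (LinearMap.inl R A R)).toAddSubgroup.index := by
  refine addIndex_eq_index_map_mul_index_comap (AddMonoidHom.inl A R) (AddMonoidHom.snd A R)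
    Prod.snd_surjective ?_ M.toAddSubgroup
  ext ⟨a, r⟩
  simp [AddSubgroup.mem_prod, eq_comm]

/-- The submodule of `A × R` generated by `N × 0` and `(a, g)`. -/
def liftSubmodule (N : Submodule R A) (g : R) (a : A) : Submodule R (A × R) where
  carrier := {x | ∃ r : R, x.1 - r • a ∈ N ∧ x.2 = r * g}
  zero_mem' := ⟨0, by simp⟩
  add_mem' := by
    rintro x y ⟨r, hr, hr'⟩ ⟨s, hs, hs'⟩
    refine ⟨r + s, ?_, by simp [hr', hs', add_mul]⟩
    have := N.add_mem hr hs
    convert this using 1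
    simp only [Prod.fst_add, add_smul]
    abel
  smul_mem' := by
    rintro c x ⟨r, hr, hr'⟩
    refine ⟨c * r, ?_, by simp [hr', mul_assoc]⟩
    have := N.smul_mem c hr
    rwa [smul_sub, ← mul_smul] at this

theorem mem_liftSubmodule {N : Submodule R A} {g : R} {a : A} {x : A × R} :
    x ∈ liftSubmodule N g a ↔ ∃ r : R, x.1 - r • a ∈ N ∧ x.2 = r * g := Iff.rfl

/-- If `(b, g)` is `r • (a, g)` modulo `N × 0`, cancelling `g` in the second coordinate gives `r =
1`. -/
theorem liftSubmodule_eq_iff [IsDomain R] {N : Submodule R A} {g : R} (hg : g ≠ 0) (a b : A) :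
    liftSubmodule N g a = liftSubmodule N g b ↔ -a + b ∈ N := by
  constructor
  · intro h
    have hb : (b, g) ∈ liftSubmodule N g a := by
      rw [h]
      exact ⟨1, by simp, by simp⟩
    obtain ⟨r, hr, hr'⟩ := hb
    obtain rfl : r = 1 := by
      have : (1 - r) * g = 0 := by rw [sub_mul, one_mul, ← hr']; simp
      rcases mul_eq_zero.1 this with h | h
      · exact (sub_eq_zero.1 h).symm
      · exact absurd h hg
    rwa [one_smul, sub_eq_neg_add] at hr
  · intro h
    ext x
    refine exists_congr fun r => and_congr_left fun _ => ?_
    have : r • (-a + b) ∈ N := N.smul_mem r h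
    rw [← N.sub_mem_iff_left this]
    apply iff_of_eq
    congr 1
    rw [smul_add, smul_neg]
    abel

/-- Any `(a, g) ∈ M` over `g` serves as the lift: subtracting a multiple of it from an element of
`M` leaves an element of `M ∩ A`. -/
theorem range_liftSubmodule [IsDomain R] (N : Submodule R A) {g : R} (hg : g ≠ 0) :
    Set.range (liftSubmodule N g) = {M | M.map (LinearMap.snd R A R) = Ideal.span {g} ∧
      M.comap (LinearMap.inl R A R) = N} := by
  ext M
  constructor
  · rintro ⟨a, rfl⟩
    constructor
    · ext s
      rw [Submodule.mem_map, Ideal.mem_span_singleton']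
      constructor
      · rintro ⟨x, ⟨r, _, hr⟩, rfl⟩
        exact ⟨r, hr.symm⟩
      · rintro ⟨r, rfl⟩
        exact ⟨(r • a, r * g), ⟨r, by simp, rfl⟩, rfl⟩
    · ext b
      rw [Submodule.mem_comap, mem_liftSubmodule]
      constructor
      · rintro ⟨r, hr, hr'⟩
        obtain rfl : r = 0 := by
          rcases mul_eq_zero.1 (show r * g = 0 from hr'.symm) with h | h
          · exact h
          · exact absurd h hg
        simpa using hr
      · intro hb
        exact ⟨0, by simpa using hb, by simp⟩
  · rintro ⟨h₁, h₂⟩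
    have hg' : g ∈ M.map (LinearMap.snd R A R) := by
      rw [h₁]
      exact Ideal.mem_span_singleton_self g
    obtain ⟨⟨a, g'⟩, haM, rfl⟩ := hg'
    refine ⟨a, ?_⟩
    have key : ∀ (x : A × R) (r : R), x.2 = r * g' → (x ∈ M ↔ x.1 - r • a ∈ N) := by
      intro x r hx
      rw [← h₂, Submodule.mem_comap, ← M.sub_mem_iff_left (M.smul_mem r haM)]
      apply iff_of_eq
      congr 1
      ext <;> simp [hx]
    ext x
    constructor
    · rintro ⟨r, hr, hr'⟩
      exact (key x r hr').2 hr
    · intro hx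
      have : x.2 ∈ M.map (LinearMap.snd R A R) := ⟨x, hx, rfl⟩
      rw [h₁, Ideal.mem_span_singleton'] at this
      obtain ⟨r, hr⟩ := this
      exact ⟨r, (key x r hr.symm).1 hx, hr.symm⟩

theorem ne_bot_of_index_ne_zero [Infinite R] {I : Ideal R} (h : I.toAddSubgroup.index ≠ 0) :
    I ≠ ⊥ := by
  rintro rfl
  exact h (by
    rw [Submodule.bot_toAddSubgroup, AddSubgroup.index_bot, Nat.card_eq_zero_of_infinite])

/-- The factor `x.2` is the number of lifts of `g` modulo the trace. As `R` is infinite, finite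
index excludes the zero ideal, so `g ≠ 0`. -/
theorem submoduleIndexCount_prod [IsDomain R] [IsPrincipalIdealRing R] [Infinite R] (N : ℕ)
    (hN : N ≠ 0) :
    submoduleIndexCount R (A × R) N = ∑ x ∈ N.divisorsAntidiagonal,
      submoduleIndexCount R R x.1 * submoduleIndexCount R A x.2 * x.2 := by
  rw [submoduleIndexCount, encard_eq_sum_fiber _ N.divisorsAntidiagonal
    (fun M => ((M.map (LinearMap.snd R A R)).toAddSubgroup.index,
      (M.comap (LinearMap.inl R A R)).toAddSubgroup.index))]
  · refine Finset.sum_congr rfl fun x hx => ?_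
    obtain ⟨hx, -⟩ := Nat.mem_divisorsAntidiagonal.1 hx
    have hx1 : x.1 ≠ 0 := fun h => hN (by rw [← hx, h, zero_mul])
    have hx2 : x.2 ≠ 0 := fun h => hN (by rw [← hx, h, mul_zero])
    have hmul : ({I : Ideal R | I.toAddSubgroup.index = x.1} ×ˢ
        {P : Submodule R A | P.toAddSubgroup.index = x.2}).encard =
        submoduleIndexCount R R x.1 * submoduleIndexCount R A x.2 := Set.encard_prod ..
    rw [← hmul]
    refine encard_eq_mul_of_fiber _ _
      (fun M => (M.map (LinearMap.snd R A R), M.comap (LinearMap.inl R A R))) _ hx2 ?_ ?_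
    · rintro M ⟨-, rfl⟩
      exact ⟨rfl, rfl⟩
    · rintro ⟨I, P⟩ ⟨hI, hP⟩
      change I.toAddSubgroup.index = x.1 at hI
      change P.toAddSubgroup.index = x.2 at hP
      obtain ⟨g, rfl⟩ := (IsPrincipalIdealRing.principal I).principal
      have hg : g ≠ 0 := by
        rintro rfl
        exact ne_bot_of_index_ne_zero (hI ▸ hx1) (by simp)
      rw [← hP, ← ncard_range_eq_index P.toAddSubgroup (liftSubmodule P g)
        (liftSubmodule_eq_iff hg), range_liftSubmodule P hg]
      congr 1
      ext M
      constructor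
      · rintro ⟨-, h⟩
        exact ⟨congrArg Prod.fst h, congrArg Prod.snd h⟩
      · rintro ⟨h₁, h₂⟩
        refine ⟨⟨?_, ?_⟩, Prod.ext h₁ h₂⟩
        · change M.toAddSubgroup.index = N
          rw [index_submodule_prod, h₁, h₂, ← hx, ← hI, ← hP]
        · rw [h₁, h₂]
          exact Prod.ext hI hP
  · intro M hM
    rw [Nat.mem_divisorsAntidiagonal]
    exact ⟨(index_submodule_prod M).symm.trans hM, hN⟩

end Prod

/-! ### Ideals of finite index in the ring of Laurent polynomials -/

open Polynomial in
theorem isCoprime_X_pow {F : Type*} [Field F] {f : F[X]} (hf : f.coeff 0 ≠ 0) (n : ℕ) :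
    IsCoprime (X ^ n) f :=
  ((Irreducible.coprime_iff_not_dvd irreducible_X).2 fun h => hf (X_dvd_iff.1 h)).pow_left

section Ideals

open Polynomial LaurentPolynomial

variable {F : Type*} [Field F]

theorem comap_span_toLaurent {f : F[X]} (hf : f.coeff 0 ≠ 0) :
    (Ideal.span {toLaurent f}).comap (toLaurent : F[X] →+* F[T;T⁻¹]) = Ideal.span {f} := by
  ext h
  rw [Ideal.mem_comap, Ideal.mem_span_singleton', Ideal.mem_span_singleton]
  constructor
  · rintro ⟨r, hr⟩
    obtain ⟨n, r', hr'⟩ := exists_T_pow r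
    refine (isCoprime_X_pow hf n).symm.dvd_of_dvd_mul_left ⟨r', ?_⟩
    apply toLaurent_injective
    rw [map_mul, map_mul, hr', toLaurent_X_pow, ← hr]
    ring
  · rintro ⟨g, rfl⟩
    exact ⟨toLaurent g, by rw [map_mul, mul_comm]⟩

/-- `X` is already invertible modulo `f`, so polynomials represent all classes: if `u * X ^ n + v *
f = 1` and `r * T n = h`, then `r = h * u + r * v * f`. -/
theorem index_span_toLaurent {f : F[X]} (hf : f.coeff 0 ≠ 0) :
    (Ideal.span {toLaurent f} : Ideal F[T;T⁻¹]).toAddSubgroup.index =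
      (Ideal.span {f}).toAddSubgroup.index := by
  rw [← comap_span_toLaurent hf]
  set I : Ideal F[T;T⁻¹] := Ideal.span {toLaurent f}
  have hsup : (toLaurent : F[X] →+* F[T;T⁻¹]).toAddMonoidHom.range ⊔ I.toAddSubgroup = ⊤ := by
    rw [eq_top_iff]
    intro r _
    obtain ⟨n, h, hh⟩ := exists_T_pow r
    obtain ⟨u, v, huv⟩ := isCoprime_X_pow hf n
    have huv' := congrArg (toLaurent : F[X] →+* F[T;T⁻¹]) huv
    simp only [map_add, map_mul, toLaurent_X_pow, toLaurent_one] at huv'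
    refine AddSubgroup.mem_sup.2 ⟨toLaurent (h * u), ⟨h * u, rfl⟩, r * toLaurent v * toLaurent f,
      I.mul_mem_left _ (Ideal.mem_span_singleton_self _), ?_⟩
    rw [map_mul, hh]
    linear_combination r * huv'
  have := AddSubgroup.index_comap I.toAddSubgroup (toLaurent : F[X] →+* F[T;T⁻¹]).toAddMonoidHom
  rw [← AddSubgroup.relIndex_sup_right, hsup, AddSubgroup.relIndex_top_right] at this
  exact this.symm

theorem index_span_of_monic {f : F[X]} (hf : f.Monic) :
    (Ideal.span {f}).toAddSubgroup.index = Nat.card F ^ f.natDegree := by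
  have : Module.Finite F (AdjoinRoot f) := (AdjoinRoot.powerBasis' hf).finite
  have h := Module.natCard_eq_pow_finrank (K := F) (V := AdjoinRoot f)
  rw [(AdjoinRoot.powerBasis' hf).finrank, AdjoinRoot.powerBasis'_dim] at h
  exact h

theorem index_span_toLaurent_of_monic {f : F[X]} (hf : f.Monic) (hf0 : f.coeff 0 ≠ 0) :
    (Ideal.span {toLaurent f} : Ideal F[T;T⁻¹]).toAddSubgroup.index = Nat.card F ^ f.natDegree := by
  rw [index_span_toLaurent hf0, index_span_of_monic hf]

theorem exists_monic_span_eq {I : Ideal F[T;T⁻¹]} (hI : I ≠ ⊥) :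
    ∃ f : F[X], f.Monic ∧ f.coeff 0 ≠ 0 ∧ Ideal.span {toLaurent f} = I := by
  set J : Ideal F[X] := I.comap (algebraMap F[X] F[T;T⁻¹]) with hJ
  have hmap : J.map (algebraMap F[X] F[T;T⁻¹]) = I :=
    IsLocalization.map_under (Submonoid.powers (X : F[X])) F[T;T⁻¹] I
  obtain ⟨g, hg⟩ := (IsPrincipalIdealRing.principal J).principal
  have hg0 : g ≠ 0 := by
    rintro rfl
    refine hI ?_
    rw [← hmap, hg]
    simp
  set f : F[X] := g * Polynomial.C g.leadingCoeff⁻¹ with hf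
  have hmonic : f.Monic := monic_mul_leadingCoeff_inv hg0
  have hJf : J = Ideal.span {f} := by
    rw [hg, hf, Ideal.span_singleton_mul_right_unit]
    exact Polynomial.isUnit_C.2 (IsUnit.mk0 _ (inv_ne_zero (leadingCoeff_ne_zero.2 hg0)))
  refine ⟨f, hmonic, fun h0 => ?_, ?_⟩
  -- If `f = X * k`, then `k ∈ J` because `T` is a unit, yet `k` has smaller degree than the
  -- generator `f`.
  · obtain ⟨k, hk⟩ := X_dvd_iff.2 h0
    have hkJ : k ∈ J := by
      have hfJ : f ∈ J := hJf ▸ Ideal.mem_span_singleton_self f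
      rw [hJ, Ideal.mem_comap, algebraMap_eq_toLaurent] at hfJ ⊢
      have := I.mul_mem_left (T (-1)) hfJ
      rwa [hk, map_mul, toLaurent_X, ← mul_assoc, ← T_add, neg_add_cancel, T_zero, one_mul] at this
    rw [hJf, Ideal.mem_span_singleton] at hkJ
    have hk0 : k ≠ 0 := by
      rintro rfl
      exact hmonic.ne_zero (by rw [hk, mul_zero])
    have := natDegree_le_of_dvd hkJ hk0
    rw [hk, natDegree_X_mul hk0] at this
    omega
  · rw [← hmap, hJf, Ideal.map_span, Set.image_singleton, algebraMap_eq_toLaurent]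

instance : Infinite F[T;T⁻¹] :=
  Infinite.of_injective (toLaurent : F[X] → F[T;T⁻¹]) toLaurent_injective

instance : IsPrincipalIdealRing F[T;T⁻¹] where
  principal I := by
    by_cases hI : I = ⊥
    · subst hI
      infer_instance
    · obtain ⟨f, -, -, rfl⟩ := exists_monic_span_eq hI
      exact ⟨⟨_, rfl⟩⟩

theorem bijOn_span_toLaurent [Finite F] (s : ℕ) :
    Set.BijOn (fun f : F[X] => (Ideal.span {toLaurent f} : Ideal F[T;T⁻¹]))
      {f | (f.Monic ∧ f.natDegree = s) ∧ f.coeff 0 ≠ 0}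
      {I | I.toAddSubgroup.index = Nat.card F ^ s} := by
  refine ⟨?_, ?_, ?_⟩
  · rintro f ⟨⟨hf, rfl⟩, hf0⟩
    exact index_span_toLaurent_of_monic hf hf0
  · rintro f ⟨⟨hf, -⟩, hf0⟩ g ⟨⟨hg, -⟩, hg0⟩ hfg
    have := congrArg (Ideal.comap (toLaurent : F[X] →+* F[T;T⁻¹])) hfg
    simp only [comap_span_toLaurent hf0, comap_span_toLaurent hg0] at this
    exact eq_of_monic_of_associated hf hg (Ideal.span_singleton_eq_span_singleton.1 this)
  · intro I hI
    change I.toAddSubgroup.index = _ at hI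
    obtain ⟨f, hf, hf0, rfl⟩ := exists_monic_span_eq (I := I)
      (ne_bot_of_index_ne_zero (by rw [hI]; exact pow_ne_zero _ Nat.card_pos.ne'))
    rw [index_span_toLaurent_of_monic hf hf0] at hI
    exact ⟨f, ⟨⟨hf, Nat.pow_right_injective Finite.one_lt_card hI⟩, hf0⟩, rfl⟩

theorem ncard_monic [Finite F] (s : ℕ) :
    {f : F[X] | f.Monic ∧ f.natDegree = s}.ncard = Nat.card F ^ s := by
  have e := (monicEquivDegreeLT (R := F) s).trans (degreeLTEquiv F s).toEquiv
  rw [← Nat.card_coe_set_eq]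
  refine (Nat.card_congr e).trans ?_
  rw [Nat.card_fun, Nat.card_fin]

/-- The monic polynomials to discard are `X` times those of degree `s`. -/
theorem ncard_monic_coeff_zero_ne_zero [Finite F] (s : ℕ) :
    {f : F[X] | (f.Monic ∧ f.natDegree = s + 1) ∧ f.coeff 0 ≠ 0}.ncard =
      Nat.card F ^ (s + 1) - Nat.card F ^ s := by
  have himage : (fun f : F[X] => X * f) '' {f : F[X] | f.Monic ∧ f.natDegree = s} =
      {f : F[X] | (f.Monic ∧ f.natDegree = s + 1) ∧ f.coeff 0 = 0} := by
    ext f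
    constructor
    · rintro ⟨g, ⟨hg, rfl⟩, rfl⟩
      exact ⟨⟨monic_X.mul hg, natDegree_X_mul hg.ne_zero⟩, by simp⟩
    · rintro ⟨⟨hf, hd⟩, h0⟩
      obtain ⟨g, rfl⟩ := X_dvd_iff.2 h0
      have hg : g.Monic := monic_X.of_mul_monic_left hf
      rw [natDegree_X_mul hg.ne_zero] at hd
      exact ⟨g, ⟨hg, by omega⟩, rfl⟩
  have hinj : Function.Injective fun f : F[X] => X * f := mul_right_injective₀ X_ne_zero
  have hdiff : {f : F[X] | (f.Monic ∧ f.natDegree = s + 1) ∧ f.coeff 0 ≠ 0} =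
      {f : F[X] | f.Monic ∧ f.natDegree = s + 1} \
        (fun f : F[X] => X * f) '' {f : F[X] | f.Monic ∧ f.natDegree = s} := by
    rw [himage]
    ext f
    change (_ ∧ _) ↔ (f.Monic ∧ f.natDegree = s + 1) ∧ ¬ (_ ∧ _)
    tauto
  have hfin : {f : F[X] | f.Monic ∧ f.natDegree = s}.Finite :=
    Set.finite_of_ncard_ne_zero (by rw [ncard_monic]; exact pow_ne_zero _ Nat.card_pos.ne')
  rw [hdiff, Set.ncard_sdiff _ (hfin.image _), Set.ncard_image_of_injective _ hinj, ncard_monic,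
    ncard_monic]
  rw [himage]
  exact fun f hf => hf.1

theorem submoduleIndexCount_self_zero :
    submoduleIndexCount F[T;T⁻¹] F[T;T⁻¹] 1 = 1 := by
  rw [submoduleIndexCount, Set.encard_eq_one]
  refine ⟨⊤, ?_⟩
  ext I
  change I.toAddSubgroup.index = 1 ↔ I = ⊤
  rw [AddSubgroup.index_eq_one, ← Submodule.toAddSubgroup_inj]
  rfl

theorem submoduleIndexCount_self_succ [Finite F] (s : ℕ) :
    submoduleIndexCount F[T;T⁻¹] F[T;T⁻¹] (Nat.card F ^ (s + 1)) =
      ((Nat.card F ^ (s + 1) - Nat.card F ^ s : ℕ) : ℕ∞) := by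
  rw [← ncard_monic_coeff_zero_ne_zero, submoduleIndexCount,
    ← encard_eq_of_bijOn _ (bijOn_span_toLaurent (F := F) (s + 1)), Set.Finite.cast_ncard_eq]
  refine Set.Finite.subset (s := {f : F[X] | f.Monic ∧ f.natDegree = s + 1}) ?_ fun f hf => hf.1
  exact Set.finite_of_ncard_ne_zero (by rw [ncard_monic]; exact pow_ne_zero _ Nat.card_pos.ne')

end Ideals

/-! ### Submodules of finite index in free modules -/

/-- The coefficients of `(1 - u) / (1 - pᵏ u)`. -/
def submoduleNumber (p k : ℕ) : ℕ → ℕ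
  | 0 => 1
  | t + 1 => p ^ (k * (t + 1)) - p ^ (k * t)

theorem submoduleNumber_succ_cast {p : ℕ} (hp : 0 < p) (k t : ℕ) :
    (submoduleNumber p k (t + 1) : ℤ) = p ^ (k * (t + 1)) - p ^ (k * t) := by
  rw [submoduleNumber, Nat.cast_sub (Nat.pow_le_pow_right hp (Nat.mul_le_mul_left k t.le_succ))]
  push_cast
  rfl

/-- The identity `(1 - p u) B_1(u) = 1 - u`, read off coefficientwise. -/
theorem submoduleNumber_one_succ {p : ℕ} (hp : 0 < p) (s : ℕ) :
    (submoduleNumber p 1 (s + 1) : ℤ) =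
      p * submoduleNumber p 1 s - if s = 0 then 1 else 0 := by
  cases s with
  | zero =>
    rw [submoduleNumber_succ_cast hp]
    simp [submoduleNumber]
  | succ s =>
    simp only [submoduleNumber_succ_cast hp, Nat.succ_ne_zero, if_false]
    ring

/-- The identity `B_1(u) B_k(p u) = B_{k+1}(u)`. Splitting off `s = 0` and applying the recurrence
for `B_1` leaves `p` times the previous sum and one correction term. -/
theorem sum_submoduleNumber {p : ℕ} (hp : 0 < p) (k t : ℕ) :
    ∑ s ∈ Finset.range (t + 1),
        submoduleNumber p 1 s * submoduleNumber p k (t - s) * p ^ (t - s) =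
      submoduleNumber p (k + 1) t := by
  zify
  induction t with
  | zero => simp [submoduleNumber]
  | succ t ih =>
    rw [Finset.sum_range_succ']
    have h : ∀ s ∈ Finset.range (t + 1), (submoduleNumber p 1 (s + 1) : ℤ) *
        submoduleNumber p k (t + 1 - (s + 1)) * (p : ℤ) ^ (t + 1 - (s + 1)) =
        p * (submoduleNumber p 1 s * submoduleNumber p k (t - s) * (p : ℤ) ^ (t - s)) -
        if s = 0 then submoduleNumber p k t * (p : ℤ) ^ t else 0 := by
      intro s _
      rw [submoduleNumber_one_succ hp, Nat.add_sub_add_right]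
      split_ifs with hs
      · subst hs
        simp only [Nat.sub_zero]
        ring
      · ring
    rw [Finset.sum_congr rfl h, Finset.sum_sub_distrib, ← Finset.mul_sum, ih,
      Finset.sum_ite_eq' (Finset.range (t + 1)) 0]
    simp only [Finset.mem_range, Nat.succ_pos, if_true, Nat.sub_zero]
    cases t with
    | zero =>
      simp only [zero_add, submoduleNumber_succ_cast hp]
      simp only [submoduleNumber]
      push_cast
      ring
    | succ t =>
      simp only [submoduleNumber_succ_cast hp]
      simp only [submoduleNumber]
      push_cast
      ring

open LaurentPolynomial

variable (p : ℕ) [Fact p.Prime]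

theorem submoduleIndexCount_self (s : ℕ) :
    submoduleIndexCount (ZMod p)[T;T⁻¹] (ZMod p)[T;T⁻¹] (p ^ s) = submoduleNumber p 1 s := by
  cases s with
  | zero => rw [pow_zero, submoduleIndexCount_self_zero]; simp [submoduleNumber]
  | succ s =>
    have := submoduleIndexCount_self_succ (F := ZMod p) s
    rw [Nat.card_zmod] at this
    rw [this, submoduleNumber, one_mul, one_mul]

theorem submoduleIndexCount_fin (k t : ℕ) :
    submoduleIndexCount (ZMod p)[T;T⁻¹] (Fin k → (ZMod p)[T;T⁻¹]) (p ^ t) =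
      submoduleNumber p k t := by
  have hp : p.Prime := Fact.out
  induction k generalizing t with
  | zero =>
    rw [submoduleIndexCount_of_subsingleton]
    cases t with
    | zero => simp [submoduleNumber]
    | succ t =>
      rw [if_neg (Nat.one_lt_pow t.succ_ne_zero hp.one_lt).ne']
      simp [submoduleNumber]
  | succ k ih =>
    rw [← submoduleIndexCount_congr ((LinearEquiv.prodComm (ZMod p)[T;T⁻¹] _ _).trans
        (Fin.consLinearEquiv (ZMod p)[T;T⁻¹] fun _ : Fin (k + 1) => (ZMod p)[T;T⁻¹])),
      submoduleIndexCount_prod _ (pow_ne_zero _ hp.ne_zero),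
      Nat.sum_divisorsAntidiagonal (fun a b => submoduleIndexCount (ZMod p)[T;T⁻¹] _ a *
        submoduleIndexCount (ZMod p)[T;T⁻¹] (Fin k → (ZMod p)[T;T⁻¹]) b * b),
      Nat.sum_divisors_prime_pow hp, ← sum_submoduleNumber hp.pos k t, Nat.cast_sum]
    refine Finset.sum_congr rfl fun s hs => ?_
    rw [Nat.pow_div (by simpa [Nat.lt_succ_iff] using hs) hp.pos, ih, submoduleIndexCount_self]
    push_cast
    rfl

theorem rank_eq_iff_natCard_eq (V : Type*) [AddCommGroup V] [Module (ZMod p) V] (t : ℕ) :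
    Module.rank (ZMod p) V = t ↔ Nat.card V = p ^ t := by
  have hp : p.Prime := Fact.out
  constructor
  · intro h
    have : Module.Finite (ZMod p) V := Module.rank_lt_aleph0_iff.1 (h ▸ Cardinal.natCast_lt_aleph0)
    rw [Module.natCard_eq_pow_finrank (K := ZMod p), Nat.card_zmod,
      Module.finrank_eq_of_rank_eq h]
  · intro h
    have : Finite V := Nat.finite_of_card_ne_zero (h ▸ pow_ne_zero _ hp.ne_zero)
    rw [Module.natCard_eq_pow_finrank (K := ZMod p), Nat.card_zmod] at h
    rw [← Module.finrank_eq_rank, Nat.pow_right_injective hp.two_le h]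

theorem submoduleCount_eq (k t : ℕ) :
    submoduleCount p k t =
      submoduleIndexCount (ZMod p)[T;T⁻¹] (Fin k → (ZMod p)[T;T⁻¹]) (p ^ t) := by
  rw [submoduleCount, submoduleIndexCount]
  congr 1
  ext M
  exact rank_eq_iff_natCard_eq p _ t

theorem submoduleCount_eq_submoduleNumber (k t : ℕ) :
    submoduleCount p k t = submoduleNumber p k t := by
  rw [submoduleCount_eq, submoduleIndexCount_fin]

/-! ### Shift-invariant subgroups of the base as modules over Laurent polynomials -/

section Base

open LaurentPolynomial

variable (p n : ℕ)

theorem shift_ofAdd_apply (s i : ℤ) (v : Multiplicative (Base p n)) :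
    Multiplicative.toAdd (shift p n (Multiplicative.ofAdd s) v) i =
      Multiplicative.toAdd v (i - s) :=
  shift_apply p n s i (Multiplicative.toAdd v)

theorem injective_mul_add {d : ℕ} (hd : d ≠ 0) (j : ℤ) :
    Function.Injective fun k : ℤ => k * d + j := fun _ _ h =>
  mul_right_cancel₀ (Nat.cast_ne_zero.2 hd) (add_right_cancel h)

/-- Sorting the coordinates of the base by their residue modulo `d`. -/
noncomputable def residueHom (d : ℕ) [NeZero d] :
    Base p n →+ (Fin (n * d) → (ZMod p)[T;T⁻¹]) where
  toFun v x := AddMonoidAlgebra.ofCoeff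
    ((v.comapDomain (fun k : ℤ => k * d + ((finProdFinEquiv.symm x).2 : ℕ))
      (injective_mul_add (NeZero.ne d) _).injOn).mapRange
        (fun u : Fin n → ZMod p => u (finProdFinEquiv.symm x).1) rfl)
  map_zero' := by
    ext x k
    simp
  map_add' v w := by
    ext x k
    simp

theorem coeff_residueHom (d : ℕ) [NeZero d] (v : Base p n) (x : Fin (n * d)) (k : ℤ) :
    (residueHom p n d v x).coeff k =
      v (k * d + ((finProdFinEquiv.symm x).2 : ℕ)) (finProdFinEquiv.symm x).1 := rfl

theorem residueHom_injective (d : ℕ) [NeZero d] : Function.Injective (residueHom p n d) := by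
  intro v w h
  ext i a
  have := congrArg (fun f => (f (finProdFinEquiv (a, (Int.divModEquiv d i).2))).coeff
    (Int.divModEquiv d i).1) h
  simp only [coeff_residueHom, Equiv.symm_apply_apply] at this
  rwa [← Int.divModEquiv_symm_apply, Equiv.symm_apply_apply] at this

theorem residueHom_surjective (d : ℕ) [NeZero d] : Function.Surjective (residueHom p n d) := by
  intro f
  let v : ℤ → Fin n → ZMod p := fun i a =>
    (f (finProdFinEquiv (a, (Int.divModEquiv d i).2))).coeff (Int.divModEquiv d i).1
  have hv : v.support.Finite := by
    refine (Set.finite_iUnion fun x : Fin (n * d) =>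
      ((f x).coeff.support.finite_toSet).image
        fun k : ℤ => k * d + ((finProdFinEquiv.symm x).2 : ℕ)).subset ?_
    intro i hi
    obtain ⟨a, ha⟩ := Function.ne_iff.1 hi
    refine Set.mem_iUnion.2 ⟨finProdFinEquiv (a, (Int.divModEquiv d i).2),
      (Int.divModEquiv d i).1, Finsupp.mem_support_iff.2 ha, ?_⟩
    simp only [Equiv.symm_apply_apply]
    rw [← Int.divModEquiv_symm_apply, Equiv.symm_apply_apply]
  refine ⟨Finsupp.ofSupportFinite v hv, ?_⟩
  ext x k
  rw [coeff_residueHom]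
  change (f (finProdFinEquiv (_, (Int.divModEquiv d _).2))).coeff (Int.divModEquiv d _).1 = _
  have : k * d + (((finProdFinEquiv.symm x).2 : ℕ) : ℤ) =
      (Int.divModEquiv d).symm (k, (finProdFinEquiv.symm x).2) := by
    rw [Int.divModEquiv_symm_apply]
  rw [this, Equiv.apply_symm_apply, Prod.mk.eta, Equiv.apply_symm_apply]

theorem coeff_T_mul {R : Type*} [CommRing R] (f : R[T;T⁻¹]) (s k : ℤ) :
    (T s * f).coeff k = f.coeff (k - s) := by
  have := AddMonoidAlgebra.coeff_single_mul_add f (1 : R) s (k - s)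
  rwa [add_sub_cancel, one_mul] at this

/-- Position `k * d + j` is recorded as the coefficient of `T k`, so moving by `d` keeps `j` and
raises `k` by one. -/
theorem residueHom_shift (d : ℕ) [NeZero d] (v : Multiplicative (Base p n)) :
    residueHom p n d (Multiplicative.toAdd (shift p n (Multiplicative.ofAdd (d : ℤ)) v)) =
      (T 1 : (ZMod p)[T;T⁻¹]) • residueHom p n d (Multiplicative.toAdd v) := by
  ext x k
  rw [coeff_residueHom, shift_ofAdd_apply, Pi.smul_apply, smul_eq_mul, coeff_T_mul,
    coeff_residueHom]
  rw [show k * d + (((finProdFinEquiv.symm x).2 : ℕ) : ℤ) - d =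
    (k - 1) * d + ((finProdFinEquiv.symm x).2 : ℕ) by ring]

/-- Scalars from `ZMod p` act as integers, so additive closure handles them; the equivalence in `h`
supplies negative powers of `T`. -/
theorem smul_mem_of_T_one_smul_mem_iff {M : Type*} [AddCommGroup M] [Module (ZMod p)[T;T⁻¹] M]
    (B : AddSubgroup M) (h : ∀ x, (T 1 : (ZMod p)[T;T⁻¹]) • x ∈ B ↔ x ∈ B)
    (r : (ZMod p)[T;T⁻¹]) {x : M} (hx : x ∈ B) : r • x ∈ B := by
  have hT : ∀ k : ℤ, ∀ x, (T k : (ZMod p)[T;T⁻¹]) • x ∈ B ↔ x ∈ B := by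
    intro k
    induction k with
    | zero => simp
    | succ k ih =>
      intro x
      rw [T_add, mul_smul, ih, h]
    | pred k ih =>
      intro x
      rw [← h, ← mul_smul, ← T_add, show (1 : ℤ) + (-k - 1) = -k by ring, ih]
  induction r using LaurentPolynomial.induction_on' with
  | add q r hq hr =>
    rw [add_smul]
    exact B.add_mem hq hr
  | C_mul_T k a =>
    obtain ⟨z, rfl⟩ := ZMod.intCast_surjective a
    rw [mul_smul, map_intCast, Int.cast_smul_eq_zsmul]
    exact B.zsmul_mem ((hT k x).2 hx) z

/-- The subgroups of the base of index `N` that are invariant under the shift by `d`. -/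
def invariantSubgroups (d : ℤ) (N : ℕ) : Set (Subgroup (Multiplicative (Base p n))) :=
  {W | (∀ v, shift p n (Multiplicative.ofAdd d) v ∈ W ↔ v ∈ W) ∧ W.index = N}

theorem encard_invariantSubgroups (d : ℕ) (hd : d ≠ 0) (N : ℕ) :
    (invariantSubgroups p n d N).encard =
      submoduleIndexCount (ZMod p)[T;T⁻¹] (Fin (n * d) → (ZMod p)[T;T⁻¹]) N := by
  have : NeZero d := ⟨hd⟩
  symm
  refine encard_eq_of_bijOn (fun M => AddSubgroup.toSubgroup
    (M.toAddSubgroup.comap (residueHom p n d))) ⟨?_, ?_, ?_⟩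
  · intro M hM
    refine ⟨fun v => ?_, (AddSubgroup.index_comap_of_surjective M.toAddSubgroup
      (residueHom_surjective p n d)).trans hM⟩
    change residueHom p n d (Multiplicative.toAdd (shift p n _ v)) ∈ M ↔
      residueHom p n d (Multiplicative.toAdd v) ∈ M
    rw [residueHom_shift]
    exact M.smul_mem_iff_of_isUnit (isUnit_T 1)
  · intro M _ M' _ h
    have := AddSubgroup.comap_injective (residueHom_surjective p n d)
      (AddSubgroup.toSubgroup.injective h)
    exact Submodule.toAddSubgroup_injective this
  · rintro W ⟨hW, rfl⟩
    set B : AddSubgroup (Fin (n * d) → (ZMod p)[T;T⁻¹]) :=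
      (Subgroup.toAddSubgroup' W).map (residueHom p n d) with hB
    have hmem : ∀ v : Multiplicative (Base p n),
        residueHom p n d (Multiplicative.toAdd v) ∈ B ↔ v ∈ W := by
      intro v
      constructor
      · rintro ⟨w, hw, hwv⟩
        have hwv' : w = Multiplicative.toAdd v := residueHom_injective p n d hwv
        subst hwv'
        exact hw
      · exact fun hv => ⟨_, hv, rfl⟩
    have hT : ∀ x, (T 1 : (ZMod p)[T;T⁻¹]) • x ∈ B ↔ x ∈ B := by
      intro x
      obtain ⟨v, rfl⟩ := residueHom_surjective p n d x
      have := residueHom_shift p n d (Multiplicative.ofAdd v)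
      rw [toAdd_ofAdd] at this
      rw [← this, hmem, hW, ← hmem, toAdd_ofAdd]
    let M : Submodule (ZMod p)[T;T⁻¹] (Fin (n * d) → (ZMod p)[T;T⁻¹]) :=
      { B with smul_mem' := fun r _ hx => smul_mem_of_T_one_smul_mem_iff p B hT r hx }
    have hMW : AddSubgroup.toSubgroup (M.toAddSubgroup.comap (residueHom p n d)) = W := by
      ext v
      exact hmem v
    refine ⟨M, ?_, hMW⟩
    change M.toAddSubgroup.index = W.index
    rw [← hMW]
    exact (AddSubgroup.index_comap_of_surjective M.toAddSubgroup
      (residueHom_surjective p n d)).symm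

end Base

/-! ### Subgroups of extensions of `ℤ` -/

section Extension

/-- Because `z` normalises `W`, the products `w * z ^ k` already form a subgroup. -/
theorem mem_sup_zpowers_iff {G : Type*} [Group G] {W : Subgroup G} {z : G}
    (hz : ∀ g, z * g * z⁻¹ ∈ W ↔ g ∈ W) (g : G) :
    g ∈ W ⊔ Subgroup.zpowers z ↔ ∃ k : ℤ, g * (z ^ k)⁻¹ ∈ W := by
  have hzW : Subgroup.zpowers z ≤ Subgroup.normalizer (W : Set G) := by
    rw [Subgroup.zpowers_le, Subgroup.mem_normalizer_iff]
    exact fun g => (hz g).symm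
  have hconj : ∀ (k : ℤ) g, z ^ k * g * (z ^ k)⁻¹ ∈ W ↔ g ∈ W := fun k g =>
    (Subgroup.mem_normalizer_iff.1 (hzW (Subgroup.zpow_mem_zpowers z k)) g).symm
  let K : Subgroup G :=
    { carrier := {g | ∃ k : ℤ, g * (z ^ k)⁻¹ ∈ W}
      one_mem' := ⟨0, by simp⟩
      mul_mem' := by
        rintro g h ⟨k, hk⟩ ⟨l, hl⟩
        refine ⟨k + l, ?_⟩
        have := W.mul_mem hk ((hconj k _).2 hl)
        convert this using 1
        rw [zpow_add]
        group
      inv_mem' := by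
        rintro g ⟨k, hk⟩
        refine ⟨-k, ?_⟩
        rw [← hconj k]
        convert W.inv_mem hk using 1
        group }
  constructor
  · have : W ⊔ Subgroup.zpowers z ≤ K := by
      refine sup_le (fun w hw => ⟨0, by simpa using hw⟩) ?_
      rw [Subgroup.zpowers_le]
      exact ⟨1, by simp⟩
    exact fun hg => this hg
  · rintro ⟨k, hk⟩
    have := Subgroup.mul_mem_sup hk (Subgroup.zpow_mem_zpowers z k)
    rwa [inv_mul_cancel_right] at this

variable {N G : Type*} [Group N] [Group G] {f : N →* G} {φ : G →* Multiplicative ℤ}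
  {W : Subgroup N} {z : G}

theorem map_sup_zpowers (hfφ : f.range = φ.ker) :
    (W.map f ⊔ Subgroup.zpowers z).map φ = Subgroup.zpowers (φ z) := by
  have h : (W.map f).map φ = ⊥ := by
    rw [Subgroup.map_eq_bot_iff, ← hfφ]
    exact Subgroup.map_le_range f W
  rw [Subgroup.map_sup, h, bot_sup_eq, MonoidHom.map_zpowers]

theorem eq_zero_of_zpow_eq_one {a : Multiplicative ℤ} (ha : a ≠ 1) {k : ℤ} (h : a ^ k = 1) :
    k = 0 := by
  have h' : k * Multiplicative.toAdd a = 0 := by simpa using congrArg Multiplicative.toAdd h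
  exact (mul_eq_zero.1 h').resolve_right fun h0 => ha (Multiplicative.toAdd.injective h0)

/-- If `w * z ^ k` lies in the kernel of `φ`, then `φ z ^ k = 1`, whence `k = 0` as `ℤ` is
torsion-free. -/
theorem comap_sup_zpowers (hf : Function.Injective f) (hfφ : f.range = φ.ker) (hφz : φ z ≠ 1)
    (hz : ∀ g, z * g * z⁻¹ ∈ W.map f ↔ g ∈ W.map f) :
    (W.map f ⊔ Subgroup.zpowers z).comap f = W := by
  have hker : ∀ w, φ (f w) = 1 := fun w => by
    rw [← MonoidHom.mem_ker, ← hfφ]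
    exact ⟨w, rfl⟩
  ext w
  rw [Subgroup.mem_comap, mem_sup_zpowers_iff hz]
  constructor
  · rintro ⟨k, w', hw', h⟩
    have h' := congrArg φ h
    rw [hker, map_mul, hker, one_mul, map_inv, map_zpow, eq_comm, inv_eq_one] at h'
    obtain rfl := eq_zero_of_zpow_eq_one hφz h'
    rw [zpow_zero, inv_one, mul_one] at h
    rwa [← hf h]
  · exact fun hw => ⟨0, by simpa using Subgroup.mem_map_of_mem f hw⟩

theorem eq_sup_zpowers (hfφ : f.range = φ.ker) {H : Subgroup G} (hzH : z ∈ H)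
    (hH : H.map φ = Subgroup.zpowers (φ z)) :
    H = (H.comap f).map f ⊔ Subgroup.zpowers z := by
  refine le_antisymm (fun h hh => ?_)
    (sup_le (Subgroup.map_comap_le f H) ((Subgroup.zpowers_le).2 hzH))
  have : φ h ∈ Subgroup.zpowers (φ z) := hH ▸ Subgroup.mem_map_of_mem φ hh
  obtain ⟨k, hk⟩ := this
  have hker : h * (z ^ k)⁻¹ ∈ f.range := by
    rw [hfφ, MonoidHom.mem_ker, map_mul, map_inv, map_zpow]
    exact mul_inv_eq_one.2 hk.symm
  obtain ⟨w, hw⟩ := hker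
  have hwH : w ∈ H.comap f := by
    rw [Subgroup.mem_comap, hw]
    exact H.mul_mem hh (H.inv_mem (H.zpow_mem hzH k))
  have := Subgroup.mul_mem_sup (Subgroup.mem_map_of_mem f hwH) (Subgroup.zpow_mem_zpowers z k)
  rwa [hw, inv_mul_cancel_right] at this

theorem sup_zpowers_eq_iff (hfφ : f.range = φ.ker) {z' : G} (hφz : φ z ≠ 1) (hzz' : φ z = φ z')
    (hz : ∀ g, z * g * z⁻¹ ∈ W.map f ↔ g ∈ W.map f) :
    W.map f ⊔ Subgroup.zpowers z = W.map f ⊔ Subgroup.zpowers z' ↔ z' * z⁻¹ ∈ W.map f := by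
  have hker : ∀ g ∈ W.map f, φ g = 1 := fun g hg => by
    rw [← MonoidHom.mem_ker, ← hfφ]
    exact Subgroup.map_le_range f W hg
  constructor
  · intro h
    have hz' : z' ∈ W.map f ⊔ Subgroup.zpowers z := by
      rw [h]
      exact Subgroup.mem_sup_right (Subgroup.mem_zpowers z')
    obtain ⟨k, hk⟩ := (mem_sup_zpowers_iff hz z').1 hz'
    have h' := hker _ hk
    rw [map_mul, map_inv, map_zpow, ← hzz'] at h'
    obtain rfl : k = 1 := by
      have := eq_zero_of_zpow_eq_one hφz (k := 1 - k) (by rwa [zpow_sub, zpow_one])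
      omega
    simpa using hk
  · intro h
    refine le_antisymm (sup_le le_sup_left ?_) (sup_le le_sup_left ?_)
    · rw [Subgroup.zpowers_le]
      have := Subgroup.mul_mem_sup ((W.map f).inv_mem h) (Subgroup.mem_zpowers z')
      simpa using this
    · rw [Subgroup.zpowers_le]
      have := Subgroup.mul_mem_sup h (Subgroup.mem_zpowers z)
      simpa using this

/-- Also covers the trivial subgroup, whose infinite index is recorded as `0`. -/
theorem eq_zpowers_index (K : Subgroup (Multiplicative ℤ)) :
    K = Subgroup.zpowers (Multiplicative.ofAdd (K.index : ℤ)) := by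
  obtain ⟨a, ha⟩ := Int.subgroup_cyclic (Subgroup.toAddSubgroup' K)
  rw [← AddSubgroup.zmultiples_eq_closure] at ha
  have hidx : K.index = a.natAbs := by
    rw [← Int.index_zmultiples a, ← ha]
    rfl
  apply Subgroup.toAddSubgroup'.injective
  rw [ha, hidx, ← Int.zmultiples_natAbs a]
  rfl

end Extension

/-! ### Subgroups of the lamplighter group -/

section LGroup

open Multiplicative

variable (p n : ℕ)

/-- The base is commutative, so `v` drops out of the conjugation. -/
theorem mk_conj_inl (v w : Multiplicative (Base p n)) (s : Multiplicative ℤ) :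
    (⟨v, s⟩ : LGroup p n) * SemidirectProduct.inl w * (⟨v, s⟩ : LGroup p n)⁻¹ =
      SemidirectProduct.inl (shift p n s w) := by
  ext1
  · simp [mul_comm v, mul_assoc]
  · simp

theorem mk_mul_inv_mk (v w : Multiplicative (Base p n)) (s : Multiplicative ℤ) :
    (⟨w, s⟩ : LGroup p n) * (⟨v, s⟩ : LGroup p n)⁻¹ = SemidirectProduct.inl (w * v⁻¹) := by
  ext1
  · simp
  · simp

variable {p n}

theorem inl_mem_map_iff {W : Subgroup (Multiplicative (Base p n))} {v} :
    (SemidirectProduct.inl v : LGroup p n) ∈ W.map SemidirectProduct.inl ↔ v ∈ W :=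
  Subgroup.mem_map_iff_mem SemidirectProduct.inl_injective

theorem mk_conj_mem_map_iff {W : Subgroup (Multiplicative (Base p n))} {s : Multiplicative ℤ}
    (hW : ∀ v, shift p n s v ∈ W ↔ v ∈ W) (v : Multiplicative (Base p n)) (g : LGroup p n) :
    (⟨v, s⟩ : LGroup p n) * g * (⟨v, s⟩ : LGroup p n)⁻¹ ∈ W.map SemidirectProduct.inl ↔
      g ∈ W.map SemidirectProduct.inl := by
  constructor
  · rintro ⟨w, hw, h⟩
    have h' := congrArg SemidirectProduct.rightHom h
    rw [map_mul, map_mul, map_inv, mul_inv_cancel_comm, SemidirectProduct.rightHom_inl] at h'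
    have hg : g ∈ (SemidirectProduct.inl : _ →* LGroup p n).range := by
      rw [SemidirectProduct.range_inl_eq_ker_rightHom]
      exact h'.symm
    obtain ⟨u, rfl⟩ := hg
    rw [mk_conj_inl] at h
    rw [SemidirectProduct.inl_injective h] at hw
    exact inl_mem_map_iff.2 ((hW u).1 hw)
  · rintro ⟨w, hw, rfl⟩
    rw [mk_conj_inl, inl_mem_map_iff, hW]
    exact hw

theorem range_sup_zpowers {W : Subgroup (Multiplicative (Base p n))} {s : Multiplicative ℤ}
    (hs : s ≠ 1) (hW : ∀ v, shift p n s v ∈ W ↔ v ∈ W) :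
    Set.range (fun v : Base p n => W.map SemidirectProduct.inl ⊔
        Subgroup.zpowers (⟨ofAdd v, s⟩ : LGroup p n)) =
      {H | H.map SemidirectProduct.rightHom = Subgroup.zpowers s ∧
        H.comap SemidirectProduct.inl = W} := by
  ext H
  constructor
  · rintro ⟨v, rfl⟩
    exact ⟨map_sup_zpowers SemidirectProduct.range_inl_eq_ker_rightHom,
      comap_sup_zpowers SemidirectProduct.inl_injective SemidirectProduct.range_inl_eq_ker_rightHom
        (z := (⟨ofAdd v, s⟩ : LGroup p n)) hs (mk_conj_mem_map_iff hW _)⟩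
  · rintro ⟨h₁, rfl⟩
    have : s ∈ H.map SemidirectProduct.rightHom := h₁ ▸ Subgroup.mem_zpowers s
    obtain ⟨⟨v, s⟩, hv, rfl⟩ := this
    exact ⟨toAdd v, (eq_sup_zpowers SemidirectProduct.range_inl_eq_ker_rightHom hv h₁).symm⟩

theorem shift_mem_comap_inl_iff {H : Subgroup (LGroup p n)} {s : Multiplicative ℤ}
    (hs : s ∈ H.map SemidirectProduct.rightHom) (v : Multiplicative (Base p n)) :
    shift p n s v ∈ H.comap SemidirectProduct.inl ↔ v ∈ H.comap SemidirectProduct.inl := by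
  obtain ⟨⟨u, s⟩, hu, rfl⟩ := hs
  rw [Subgroup.mem_comap, Subgroup.mem_comap]
  change SemidirectProduct.inl (shift p n s v) ∈ H ↔ _
  rw [← mk_conj_inl p n u, H.mul_mem_cancel_right (H.inv_mem hu), H.mul_mem_cancel_left hu]

theorem ncard_subgroups_of_comap_eq {W : Subgroup (Multiplicative (Base p n))}
    {s : Multiplicative ℤ} (hs : s ≠ 1) (hW : ∀ v, shift p n s v ∈ W ↔ v ∈ W) :
    {H : Subgroup (LGroup p n) | H.map SemidirectProduct.rightHom = Subgroup.zpowers s ∧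
      H.comap SemidirectProduct.inl = W}.ncard = W.index := by
  rw [← range_sup_zpowers hs hW]
  refine ncard_range_eq_index (Subgroup.toAddSubgroup' W) _ fun v w => ?_
  have := sup_zpowers_eq_iff SemidirectProduct.range_inl_eq_ker_rightHom
    (z := (⟨ofAdd v, s⟩ : LGroup p n)) (z' := ⟨ofAdd w, s⟩) hs rfl (mk_conj_mem_map_iff hW _)
  rw [this, mk_mul_inv_mk, inl_mem_map_iff, mul_comm]
  rfl

theorem index_eq_index_map_rightHom_mul (H : Subgroup (LGroup p n)) :
    H.index = (H.map SemidirectProduct.rightHom).index *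
      (H.comap SemidirectProduct.inl).index :=
  index_eq_index_map_mul_index_comap _ _ SemidirectProduct.rightHom_surjective
    SemidirectProduct.range_inl_eq_ker_rightHom H

theorem exists_index_eq_pow [Fact p.Prime] {W : Subgroup (Multiplicative (Base p n))}
    (hW : W.index ≠ 0) : ∃ t, W.index = p ^ t := by
  have : W.FiniteIndex := ⟨hW⟩
  refine IsPGroup.index (p := p) (fun v => ⟨1, ?_⟩) W
  apply toAdd.injective
  ext i a
  simp

theorem subgroupCount_eq_sum [Fact p.Prime] {m : ℕ} (hm : m ≠ 0) :
    subgroupCount p n m = ∑ t ∈ Finset.range (m + 1) with p ^ t ∣ m,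
      (invariantSubgroups p n (m / p ^ t : ℕ) (p ^ t)).encard * (p ^ t : ℕ) := by
  have hp : p.Prime := Fact.out
  have key : ∀ H : Subgroup (LGroup p n), H.index = m →
      ∃ t, p ^ t ∣ m ∧ (H.comap SemidirectProduct.inl).index = p ^ t := by
    intro H hH
    rw [index_eq_index_map_rightHom_mul] at hH
    obtain ⟨t, ht⟩ := exists_index_eq_pow (right_ne_zero_of_mul (hH ▸ hm))
    exact ⟨t, ⟨_, by rw [← hH, ht, mul_comm]⟩, ht⟩
  rw [subgroupCount, encard_eq_sum_fiber _ _
    -- The trace has index `p ^ t`, and the logarithm recovers `t`.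
    (fun H => Nat.log p (H.comap SemidirectProduct.inl).index)]
  · refine Finset.sum_congr rfl fun t ht => ?_
    obtain ⟨-, d, hd⟩ := Finset.mem_filter.1 ht
    have hpt : 0 < p ^ t := pow_pos hp.pos t
    have hd0 : d ≠ 0 := by
      rintro rfl
      exact hm hd
    rw [hd, Nat.mul_div_cancel_left d hpt]
    have hiff : ∀ H : Subgroup (LGroup p n), (H.index = p ^ t * d ∧
        Nat.log p (H.comap SemidirectProduct.inl).index = t) ↔
        (H.map SemidirectProduct.rightHom = Subgroup.zpowers (ofAdd (d : ℤ)) ∧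
          (H.comap SemidirectProduct.inl).index = p ^ t) := by
      intro H
      constructor
      · rintro ⟨hH, hlog⟩
        obtain ⟨t', -, ht'⟩ := key H (hd ▸ hH)
        rw [ht', Nat.log_pow hp.one_lt] at hlog
        subst hlog
        rw [index_eq_index_map_rightHom_mul, ht', mul_comm] at hH
        refine ⟨?_, ht'⟩
        rw [← Nat.eq_of_mul_eq_mul_left hpt hH]
        exact eq_zpowers_index _
      · rintro ⟨h₁, h₂⟩
        refine ⟨?_, by rw [h₂, Nat.log_pow hp.one_lt]⟩
        rw [index_eq_index_map_rightHom_mul, h₁, h₂, mul_comm]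
        congr 1
        exact (Int.index_zmultiples (d : ℤ)).trans (Int.natAbs_natCast d)
    have hs : ofAdd (d : ℤ) ≠ 1 := by
      simpa using hd0
    refine encard_eq_mul_of_fiber _ _ (fun H => H.comap SemidirectProduct.inl) _ hpt.ne' ?_ ?_
    · intro H hH
      obtain ⟨h₁, h₂⟩ := (hiff H).1 hH
      exact ⟨shift_mem_comap_inl_iff (h₁ ▸ Subgroup.mem_zpowers _), h₂⟩
    · rintro W ⟨hW, hWt⟩
      refine (congrArg Set.ncard ?_).trans ((ncard_subgroups_of_comap_eq hs hW).trans hWt)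
      ext H
      constructor
      · rintro ⟨hH, h⟩
        exact ⟨((hiff H).1 hH).1, h⟩
      · rintro ⟨h₁, h₂⟩
        exact ⟨(hiff H).2 ⟨h₁, by rw [h₂, hWt]⟩, h₂⟩
  · intro H hH
    obtain ⟨t, htm, ht⟩ := key H hH
    rw [ht, Nat.log_pow hp.one_lt, Finset.mem_filter, Finset.mem_range]
    exact ⟨(((Nat.lt_pow_self hp.one_lt).trans_le
      (Nat.le_of_dvd (Nat.pos_of_ne_zero hm) htm))).trans (Nat.lt_succ_self m), htm⟩

end LGroup

end Lamplighter

/-- In both sums `t` ranges over all `t` (resp. all `t ≥ 1`) with `p ^ t ∣ m`; as `m ≥ 1`, such a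
`t` satisfies `t < p ^ t ≤ m`, so the bounds on `t` lose nothing. All divisions are exact and
the subtractions do not truncate. The last sum, being a natural number, shows that the count
is finite. -/
theorem proposition3p6 (p : ℕ) (hp : p.Prime) (n m : ℕ) (hm : 1 ≤ m) :
    Lamplighter.subgroupCount p n m
        = ∑ t ∈ Finset.range (m + 1) with p ^ t ∣ m,
            Lamplighter.submoduleCount p (n * m / p ^ t) t * (p : ℕ∞) ^ t ∧
    Lamplighter.subgroupCount p n m
        = ((∑ t ∈ Finset.Icc 1 m with p ^ t ∣ m,
              (p ^ (n * m * t / p ^ t) - p ^ (n * m * (t - 1) / p ^ t)) * p ^ t + 1 : ℕ) : ℕ∞) := by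
  have : Fact p.Prime := ⟨hp⟩
  have hfirst : Lamplighter.subgroupCount p n m
      = ∑ t ∈ Finset.range (m + 1) with p ^ t ∣ m,
          Lamplighter.submoduleCount p (n * m / p ^ t) t * (p : ℕ∞) ^ t := by
    rw [Lamplighter.subgroupCount_eq_sum (by omega)]
    refine Finset.sum_congr rfl fun t ht => ?_
    obtain ⟨-, hdvd⟩ := Finset.mem_filter.1 ht
    rw [Lamplighter.encard_invariantSubgroups _ _ _
      (Nat.div_pos (Nat.le_of_dvd hm hdvd) (pow_pos hp.pos t)).ne', Lamplighter.submoduleCount_eq,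
      Nat.mul_div_assoc n hdvd, Nat.cast_pow]
  refine ⟨hfirst, ?_⟩
  rw [hfirst]
  -- The term `t = 0` is split off: it is the summand `1`.
  have hrange : (Finset.range (m + 1)).filter (fun t => p ^ t ∣ m) =
      insert 0 ((Finset.Icc 1 m).filter fun t => p ^ t ∣ m) := by
    ext t
    simp only [Finset.mem_filter, Finset.mem_range, Finset.mem_insert, Finset.mem_Icc]
    constructor
    · rintro ⟨h₁, h₂⟩
      by_cases h : t = 0
      · exact Or.inl h
      · exact Or.inr ⟨by omega, h₂⟩
    · rintro (rfl | ⟨h₁, h₂⟩)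
      · exact ⟨by omega, by simp⟩
      · exact ⟨by omega, h₂⟩
  rw [hrange, Finset.sum_insert (by simp), add_comm, Nat.cast_add, Nat.cast_sum]
  congr 1
  · refine Finset.sum_congr rfl fun t ht => ?_
    simp only [Finset.mem_filter, Finset.mem_Icc] at ht
    obtain ⟨⟨ht, -⟩, hdvd⟩ := ht
    obtain ⟨t, rfl⟩ := Nat.exists_eq_add_of_le' ht
    have hdiv : ∀ j, n * m * j / p ^ (t + 1) = n * m / p ^ (t + 1) * j := fun j => by
      rw [mul_comm, Nat.mul_div_assoc j (hdvd.mul_left n), mul_comm]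
    rw [Lamplighter.submoduleCount_eq_submoduleNumber, hdiv, hdiv, Nat.add_sub_cancel]
    simp only [Lamplighter.submoduleNumber]
    push_cast
    rfl
  · rw [Lamplighter.submoduleCount_eq_submoduleNumber]
    simp [Lamplighter.submoduleNumber]
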